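/- Let $(M,\phi,\xi,\eta,g)$ be a nearly Sasakian manifold of dimension $2n+1$: $M$ is a smooth manifold with a smooth $(1,1)$-tensor field $\phi$, a smooth vector field $\xi$, a smooth $1$-form $\eta$ and a Riemannian metric $g$ such that $$\phi^2=-I+\eta\otimes\xi,\qquad \eta(\xi)=1,\qquad g(\phi X,\phi Y)=g(X,Y)-\eta(X)\eta(Y),$$ and, for the Levi-Civita connection $\nabla$ of $g$, $$(\nabla_X\phi)Y+(\nabla_Y\phi)X=2g(X,Y)\xi-\eta(X)Y-\eta(Y)X$$ for all vector fields $X,Y$. Let $h$ be the $(1,1)$-tensor field with $\nabla_X\xi=-\phi X+hX$. Fix a real number $r$. Then there exists a unique linear connection $\bar\nabla$ on $M$ which parallelizes all the structure tensors ($\bar\nabla\phi=0$, $\bar\nabla\xi=0$, $\bar\nabla\eta=0$, $\bar\nabla g=0$) and whose torsion tensor $\bar T$ satisfies: 1) $\bar T$ is totally skew-symmetric on $\ker\eta$, i.e. $g(\bar T(X,Y),Z)$ is totally skew-symmetric in $X,Y,Z\in\ker\eta$; 2) the $(1,1)$-tensor field $\tau X=\bar T(\xi,X)$ satisfies $\tau\phi+\phi\tau=-2(r+1)\phi^2$.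 This connection is given by $\bar\nabla_XY=\nabla_XY+H(X,Y)$, where $$H(X,Y)=\tfrac12(\nabla_X\phi)\phi Y-r\,\eta(X)\phi Y+\eta(Y)(\phi-h)X-\tfrac12 g((\phi-h)X,Y)\xi .$$ If moreover $(\phi,\xi,\eta,g)$ is Sasakian, i.e. $[\phi,\phi]+d\eta\otimes\xi=0$ and $d\eta(X,Y)=2g(X,\phi Y)$, where $[\phi,\phi]$ is the Nijenhuis torsion of $\phi$ and $d\eta(X,Y)=X(\eta(Y))-Y(\eta(X))-\eta([X,Y])$, then $\bar\nabla$ is the Okumura connection $$\bar\nabla_XY=\nabla_XY+g(X,\phi Y)\xi-r\,\eta(X)\phi Y+\eta(Y)\phi X .$$ -/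

import Mathlib

open Bundle FiberBundle VectorField
open scoped Manifold ContDiff

set_option linter.unusedSectionVars false

namespace NearlySasakian

noncomputable section

section LeviCivita

variable {E : Type*} [NormedAddCommGroup E] [NormedSpace ℝ E]
  {H : Type*} [TopologicalSpace H] {I : ModelWithCorners ℝ E H}
  {M : Type*} [TopologicalSpace M] [ChartedSpace H M] [IsManifold I ∞ M]
  (g : ContMDiffRiemannianMetric I ∞ E (fun x : M ↦ TangentSpace I x))
  {x : M} {X Y Z : Π x : M, TangentSpace I x}

lemma mdiffAt_metric {X Y : Π x : M, TangentSpace I x} (hX : MDiffAt (T% X) x)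
    (hY : MDiffAt (T% Y) x) : MDiffAt (fun y ↦ g.inner y (X y) (Y y)) x := by
  have h : MDifferentiableAt I (I.prod 𝓘(ℝ))
      (fun m : M ↦ TotalSpace.mk' ℝ (E := Bundle.Trivial M ℝ) m (g.inner m (X m) (Y m))) x := by
    apply MDifferentiableAt.clm_bundle_apply₂ (F₁ := E) (F₂ := E)
    · exact (g.contMDiff x).mdifferentiableAt (by simp)
    · exact hX
    · exact hY
  simp only [mdifferentiableAt_totalSpace] at h
  exact h.2

/-- The inner product `g_x` as an algebraic bilinear form on `T_x M`. -/
def bilin (x : M) : LinearMap.BilinForm ℝ (TangentSpace I x) :=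
  LinearMap.mk₂ ℝ (fun v w ↦ g.inner x v w) (by simp) (by simp) (by simp) (by simp)

lemma bilin_nondegenerate (x : M) : (bilin g x).Nondegenerate := by
  refine ⟨fun v hv ↦ ?_, fun v hv ↦ ?_⟩ <;>
  · by_contra h
    exact (g.pos x v h).ne' (hv v)


/-- The right-hand side of the Koszul formula for `2 g(∇_X Y, Z)`, with the argument order
`Y, X, Z`. -/
def koszul (Y X Z : Π x : M, TangentSpace I x) (x : M) : ℝ :=
  d% (fun y ↦ g.inner y (Y y) (Z y)) x (X x) + d% (fun y ↦ g.inner y (X y) (Z y)) x (Y x)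
    - d% (fun y ↦ g.inner y (X y) (Y y)) x (Z x)
    + g.inner x (mlieBracket I X Y x) (Z x) - g.inner x (mlieBracket I X Z x) (Y x)
    - g.inner x (mlieBracket I Y Z x) (X x)

variable [CompleteSpace E]

lemma koszul_tensorial₁ (hY : MDiffAt (T% Y) x) 
    (hZ : MDiffAt (T% Z) x) : TensorialAt I E (fun X ↦ koszul g Y X Z x) x where
  smul {f X} hf hX := by
    simp [koszul, mvfderiv_fun_mul hf (mdiffAt_metric g hX hZ),
      mvfderiv_fun_mul hf (mdiffAt_metric g hX hY),
      mlieBracket_smul_left hf hX]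
    rw [g.symm x (X x) (Y x)]
    ring
  add hX hX' := by
    simp [koszul, mvfderiv_fun_add (mdiffAt_metric g hX hZ) (mdiffAt_metric g hX' hZ), 
      mvfderiv_fun_add (mdiffAt_metric g hX hY) (mdiffAt_metric g hX' hY), 
      mlieBracket_add_left hX hX']
    ring

lemma koszul_tensorial₃ (hY : MDiffAt (T% Y) x) 
    (hX : MDiffAt (T% X) x) : TensorialAt I E (fun Z ↦ koszul g Y X Z x) x where
  smul {f Z} hf hZ := by
    simp [koszul, mvfderiv_fun_mul hf (mdiffAt_metric g hX hZ),
      mvfderiv_fun_mul hf (mdiffAt_metric g hY hZ),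
      mlieBracket_smul_right hf hZ]
    rw [g.symm x (Z x) (Y x), g.symm x (Z x) (X x)]
    ring
  add hZ hZ' := by
    simp [koszul, mvfderiv_fun_add (mdiffAt_metric g hX hZ) (mdiffAt_metric g hX hZ'), 
      mvfderiv_fun_add (mdiffAt_metric g hY hZ) (mdiffAt_metric g hY hZ'), 
      mlieBracket_add_right hZ hZ']
    ring

variable [FiniteDimensional ℝ E]

/-- The bilinear form `(X, Z) ↦ 2 g(∇_X Y, Z)` at `x`. -/
def koszulForm (Y : Π x : M, TangentSpace I x) (hY : MDiffAt (T% Y) x) :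
    TangentSpace I x →L[ℝ] TangentSpace I x →L[ℝ] ℝ :=
  TensorialAt.mkHom₂ (fun X Z ↦ koszul g Y X Z x) x
    (fun _ hZ ↦ koszul_tensorial₁ g hY hZ) (fun _ hX ↦ koszul_tensorial₃ g hY hX)

open scoped Classical in
/-- The covariant derivative `X ↦ ∇_X Y` of the Levi-Civita connection of `g` at `x`: the vector
`∇_v Y` is determined by the Koszul formula, through the isomorphism `T_x M ≃ (T_x M)^*` given by
`g`. As for every derivative in Mathlib, the value at a field that is not differentiable at `x`
is zero. -/
def leviCivitaFun (Y : Π x : M, TangentSpace I x) (x : M) :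
    TangentSpace I x →L[ℝ] TangentSpace I x :=
  haveI : FiniteDimensional ℝ (TangentSpace I x) := inferInstanceAs (FiniteDimensional ℝ E)
  haveI : T2Space (TangentSpace I x) := inferInstanceAs (T2Space E)
  if h : MDiffAt (T% Y) x then
    LinearMap.toContinuousLinearMap
      { toFun v := (1 / 2 : ℝ) • ((bilin g x).toDual (bilin_nondegenerate g x)).symm
          (koszulForm g Y h v : TangentSpace I x →ₗ[ℝ] ℝ)
        map_add' := by
          intro v w
          rw [map_add, ContinuousLinearMap.toLinearMap_add, map_add, smul_add]
        map_smul' := by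
          intro c v
          rw [map_smul, ContinuousLinearMap.toLinearMap_smul, map_smul, smul_comm]
          rfl }
  else 0

lemma metric_leviCivitaFun (hX : MDiffAt (T% X) x) (hY : MDiffAt (T% Y) x)
    (hZ : MDiffAt (T% Z) x) :
    g.inner x (leviCivitaFun g Y x (X x)) (Z x) = 1 / 2 * koszul g Y X Z x := by
  have h1 : koszulForm g Y hY (X x) (Z x) = koszul g Y X Z x :=
    TensorialAt.mkHom₂_apply (fun _ hZ ↦ koszul_tensorial₁ g hY hZ)
      (fun _ hX ↦ koszul_tensorial₃ g hY hX) hX hZ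
  have : FiniteDimensional ℝ (TangentSpace I x) := inferInstanceAs (FiniteDimensional ℝ E)
  have h2 := LinearMap.BilinForm.apply_toDual_symm_apply (hB := bilin_nondegenerate g x)
    (koszulForm g Y hY (X x) : TangentSpace I x →ₗ[ℝ] ℝ) (Z x)
  rw [← h1]
  simp only [leviCivitaFun, dif_pos hY]
  change g.inner x ((1 / 2 : ℝ) • _) (Z x) = _
  rw [map_smul, smul_apply, smul_eq_mul]
  exact congrArg _ h2

lemma metric_ext {A B : TangentSpace I x →L[ℝ] TangentSpace I x}
    (h : ∀ X Z : Π x : M, TangentSpace I x, MDiffAt (T% X) x → MDiffAt (T% Z) x →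
      g.inner x (A (X x)) (Z x) = g.inner x (B (X x)) (Z x)) : A = B := by
  ext v
  by_contra hne
  have h1 := h (extend E v) (extend E (A v - B v)) (mdifferentiableAt_extend ..)
    (mdifferentiableAt_extend ..)
  have h2 := g.pos x (A v - B v) (sub_ne_zero.mpr hne)
  simp at h1 h2
  linarith

/-- The Levi-Civita connection of `g`, as a covariant derivative on the tangent bundle. -/
def leviCivita : CovariantDerivative I E (fun x : M ↦ TangentSpace I x) where
  toFun := leviCivitaFun g
  isCovariantDerivativeOnUniv :=
    { add := by
        intro Y Y' x hY hY' _
        refine metric_ext g fun X Z hX hZ ↦ ?_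
        rw [metric_leviCivitaFun g hX (mdifferentiableAt_add_section hY hY') hZ]
        simp [metric_leviCivitaFun g hX hY hZ, metric_leviCivitaFun g hX hY' hZ]
        simp [koszul, mvfderiv_fun_add (mdiffAt_metric g hY hZ) (mdiffAt_metric g hY' hZ),
          mvfderiv_fun_add (mdiffAt_metric g hX hY) (mdiffAt_metric g hX hY'),
          mlieBracket_add_right hY hY', mlieBracket_add_left hY hY']
        ring
      leibniz := by
        intro Y f x hY hf _
        refine metric_ext g fun X Z hX hZ ↦ ?_
        rw [metric_leviCivitaFun g hX (hf.smul_section hY) hZ]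
        simp [metric_leviCivitaFun g hX hY hZ]
        simp [koszul, mvfderiv_fun_mul hf (mdiffAt_metric g hY hZ),
          mvfderiv_fun_mul hf (mdiffAt_metric g hX hY),
          mlieBracket_smul_right hf hY, mlieBracket_smul_left hf hY]
        rw [g.symm x (Y x) (X x)]
        ring }

/-- `leviCivita g` is torsion-free. -/
theorem leviCivita_torsion : (leviCivita g).torsion = 0 := by
  rw [CovariantDerivative.torsion_eq_zero_iff]
  intro X Y x hX hY
  by_contra hne
  have h2 := g.pos x _ (sub_ne_zero.mpr hne)
  set W := leviCivita g Y x (X x) - leviCivita g X x (Y x) - mlieBracket I X Y x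
  have hZ := mdifferentiableAt_extend I E W
  have a := metric_leviCivitaFun g hX hY hZ
  have b := metric_leviCivitaFun g hY hX hZ
  have c : g.inner x W (extend E W x) = 0 := by
    simp only [W, map_sub, sub_apply]
    change g.inner x (leviCivitaFun g Y x (X x)) _ - g.inner x (leviCivitaFun g X x (Y x)) _ - _ = 0
    have hb : mlieBracket I Y X x = - mlieBracket I X Y x := mlieBracket_swap_apply
    have hs : (fun y ↦ g.inner y (X y) (Y y)) = fun y ↦ g.inner y (Y y) (X y) :=
      funext fun y ↦ g.symm y _ _
    rw [a, b]
    simp only [koszul, hb, hs, map_neg, neg_apply]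
    ring
  simp only [extend_apply_self] at c
  exact h2.ne' c

/-- `leviCivita g` is a metric connection. -/
theorem leviCivita_metric (hY : MDiffAt (T% Y) x) (hZ : MDiffAt (T% Z) x)
    (v : TangentSpace I x) :
    d% (fun y ↦ g.inner y (Y y) (Z y)) x v =
      g.inner x (leviCivita g Y x v) (Z x) + g.inner x (Y x) (leviCivita g Z x v) := by
  have hX := mdifferentiableAt_extend I E v
  have a := metric_leviCivitaFun g hX hY hZ
  have b := metric_leviCivitaFun g hX hZ hY
  simp only [extend_apply_self] at a b
  rw [g.symm x (Y x)]
  change _ = g.inner x (leviCivitaFun g Y x v) _ + g.inner x (leviCivitaFun g Z x v) _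
  have hb : mlieBracket I Z Y x = - mlieBracket I Y Z x := mlieBracket_swap_apply
  have hs : (fun y ↦ g.inner y (Z y) (Y y)) = fun y ↦ g.inner y (Y y) (Z y) :=
    funext fun y ↦ g.symm y _ _
  rw [a, b]
  simp only [koszul, hb, hs, map_neg, neg_apply, extend_apply_self]
  ring

end LeviCivita

section Connections

variable {E : Type*} [NormedAddCommGroup E] [NormedSpace ℝ E]
  {H : Type*} [TopologicalSpace H] {I : ModelWithCorners ℝ E H}
  {M : Type*} [TopologicalSpace M] [ChartedSpace H M] [IsManifold I ∞ M]

/-- `D = D₀ + A` for two connections and a `(1,2)`-tensor field `A`, i.e. `D_v Y = D₀_v Y + A(v, Y)`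
for every vector field `Y` that is differentiable at the base point of `v`. (The value of a covariant
derivative of Mathlib at a non-differentiable field has no meaning.) -/
def EqAdd (D D₀ : CovariantDerivative I E (fun x : M ↦ TangentSpace I x))
    (A : Π x : M, TangentSpace I x → TangentSpace I x → TangentSpace I x) : Prop :=
  ∀ (x : M) (v : TangentSpace I x) (Y : Π x : M, TangentSpace I x), MDiffAt (T% Y) x →
    D Y x v = D₀ Y x v + A x v (Y x)

/-- Two connections are the same: they have the same values on every vector field `Y`, at every point
at which `Y` is differentiable. -/
def SameConnection (D D' : CovariantDerivative I E (fun x : M ↦ TangentSpace I x)) : Prop :=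
  ∀ (x : M) (v : TangentSpace I x) (Y : Π x : M, TangentSpace I x), MDiffAt (T% Y) x →
    D Y x v = D' Y x v

end Connections

section Structures

variable {E : Type*} [NormedAddCommGroup E] [NormedSpace ℝ E]
  {H : Type*} [TopologicalSpace H] (I : ModelWithCorners ℝ E H)
  (M : Type*) [TopologicalSpace M] [ChartedSpace H M] [IsManifold I ∞ M]

/-- An almost contact metric structure `(φ, ξ, η, g)` on `M`: a smooth `(1,1)`-tensor field `φ`, a
smooth vector field `ξ`, a smooth one-form `η` and a smooth Riemannian metric `g` such that
`φ² = -I + η ⊗ ξ`, `η(ξ) = 1` and `g(φX, φY) = g(X, Y) - η(X) η(Y)`. -/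
structure AlmostContactMetricStructure where
  /-- the Riemannian metric -/
  g : ContMDiffRiemannianMetric I ∞ E (fun x : M ↦ TangentSpace I x)
  /-- the `(1,1)`-tensor field -/
  φ : Π x : M, TangentSpace I x →L[ℝ] TangentSpace I x
  /-- the characteristic vector field -/
  ξ : Π x : M, TangentSpace I x
  /-- the one-form -/
  η : Π x : M, TangentSpace I x →L[ℝ] ℝ
  smooth_φ : ContMDiff I (I.prod 𝓘(ℝ, E →L[ℝ] E)) ∞
    (fun x ↦ TotalSpace.mk' (E →L[ℝ] E) (E := fun x : M ↦ TangentSpace I x →L[ℝ] TangentSpace I x)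
      x (φ x))
  smooth_ξ : ContMDiff I (I.prod 𝓘(ℝ, E)) ∞
    (fun x ↦ TotalSpace.mk' E (E := fun x : M ↦ TangentSpace I x) x (ξ x))
  smooth_η : ContMDiff I (I.prod 𝓘(ℝ, E →L[ℝ] ℝ)) ∞
    (fun x ↦ TotalSpace.mk' (E →L[ℝ] ℝ) (E := fun x : M ↦ TangentSpace I x →L[ℝ] ℝ) x (η x))
  φ_φ : ∀ (x : M) (v : TangentSpace I x), φ x (φ x v) = -v + η x v • ξ x
  η_ξ : ∀ x : M, η x (ξ x) = 1
  g_φ_φ : ∀ (x : M) (v w : TangentSpace I x),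
    g.inner x (φ x v) (φ x w) = g.inner x v w - η x v * η x w

end Structures

namespace AlmostContactMetricStructure

variable {E : Type*} [NormedAddCommGroup E] [NormedSpace ℝ E]
  {H : Type*} [TopologicalSpace H] {I : ModelWithCorners ℝ E H}
  {M : Type*} [TopologicalSpace M] [ChartedSpace H M] [IsManifold I ∞ M]
  (S : AlmostContactMetricStructure I M)

lemma mdiffAt_φ {x : M} {Y : Π x : M, TangentSpace I x} (hY : MDiffAt (T% Y) x) :
    MDiffAt (T% (fun y ↦ S.φ y (Y y))) x :=
  MDifferentiableAt.clm_bundle_apply (F₁ := E) (F₂ := E)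
    ((S.smooth_φ x).mdifferentiableAt (by simp)) hY

lemma covDeriv_φ_tensorial (D : CovariantDerivative I E (fun x : M ↦ TangentSpace I x)) (x : M) :
    TensorialAt I E
      (fun Y : Π x : M, TangentSpace I x ↦ D (fun y ↦ S.φ y (Y y)) x - S.φ x ∘L D Y x) x where
  smul {f Y} hf hY := by
    have h : (fun y ↦ S.φ y ((f • Y) y)) = f • fun y ↦ S.φ y (Y y) := by ext y; simp
    rw [h, D.isCovariantDerivativeOnUniv.leibniz (S.mdiffAt_φ hY) hf,
      D.isCovariantDerivativeOnUniv.leibniz hY hf]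
    ext v
    simp [smul_sub]
  add {Y Y'} hY hY' := by
    have h : (fun y ↦ S.φ y ((Y + Y') y)) =
        (fun y ↦ S.φ y (Y y)) + fun y ↦ S.φ y (Y' y) := by ext y; simp
    rw [h, D.isCovariantDerivativeOnUniv.add (S.mdiffAt_φ hY) (S.mdiffAt_φ hY'),
      D.isCovariantDerivativeOnUniv.add hY hY']
    ext v
    simp
    abel

variable [FiniteDimensional ℝ E]

/-- The covariant derivative `(D_v φ) w` of the tensor field `φ`. -/
def covDerivφ (D : CovariantDerivative I E (fun x : M ↦ TangentSpace I x)) (x : M)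
    (v w : TangentSpace I x) : TangentSpace I x :=
  TensorialAt.mkHom _ x (S.covDeriv_φ_tensorial D x) w v

/-- `(D_v φ) Y = D_v (φ Y) - φ (D_v Y)`. -/
theorem covDerivφ_apply (D : CovariantDerivative I E (fun x : M ↦ TangentSpace I x)) {x : M}
    (v : TangentSpace I x) {Y : Π x : M, TangentSpace I x} (hY : MDiffAt (T% Y) x) :
    S.covDerivφ D x v (Y x) = D (fun y ↦ S.φ y (Y y)) x v - S.φ x (D Y x v) := by
  rw [covDerivφ, TensorialAt.mkHom_apply (S.covDeriv_φ_tensorial D x) hY]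
  rfl

variable [CompleteSpace E]

/-- The structure is nearly Sasakian if
`(∇_X φ) Y + (∇_Y φ) X = 2 g(X, Y) ξ - η(X) Y - η(Y) X`, with `∇` the Levi-Civita connection. -/
def IsNearlySasakian : Prop :=
  ∀ (x : M) (v w : TangentSpace I x),
    S.covDerivφ (leviCivita S.g) x v w + S.covDerivφ (leviCivita S.g) x w v =
      (2 * S.g.inner x v w) • S.ξ x - S.η x v • w - S.η x w • v

/-- The exterior derivative `dη(X, Y) = X(η(Y)) - Y(η(X)) - η([X, Y])`. -/
def dη (X Y : Π x : M, TangentSpace I x) (x : M) : ℝ :=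
  d% (fun y ↦ S.η y (Y y)) x (X x) - d% (fun y ↦ S.η y (X y)) x (Y x)
    - S.η x (mlieBracket I X Y x)

/-- The tensor field `N_φ = [φ, φ] + dη ⊗ ξ`, where
`[φ, φ](X, Y) = φ²[X, Y] + [φX, φY] - φ[φX, Y] - φ[X, φY]`. -/
def normality (X Y : Π x : M, TangentSpace I x) (x : M) : TangentSpace I x :=
  S.φ x (S.φ x (mlieBracket I X Y x))
    + mlieBracket I (fun y ↦ S.φ y (X y)) (fun y ↦ S.φ y (Y y)) x
    - S.φ x (mlieBracket I (fun y ↦ S.φ y (X y)) Y x)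
    - S.φ x (mlieBracket I X (fun y ↦ S.φ y (Y y)) x)
    + S.dη X Y x • S.ξ x

/-- The structure is Sasakian if `N_φ = 0` and `dη = 2Φ`, where `Φ(X, Y) = g(X, φY)` (tested on
vector fields that are smooth at the point under consideration). -/
def IsSasakian : Prop :=
  ∀ (x : M) (X Y : Π x : M, TangentSpace I x),
    CMDiffAt ∞ (T% X) x → CMDiffAt ∞ (T% Y) x →
      S.normality X Y x = 0 ∧ S.dη X Y x = 2 * S.g.inner x (X x) (S.φ x (Y x))

/-- The `(1,1)`-tensor field `h` with `∇_X ξ = -φX + hX`. -/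
def h (x : M) : TangentSpace I x →L[ℝ] TangentSpace I x :=
  leviCivita S.g S.ξ x + S.φ x

/-- The `(1,2)`-tensor field
`H(X, Y) = 1/2 (∇_X φ)φY - r η(X) φY + η(Y) (φ - h)X - 1/2 g((φ - h)X, Y) ξ`. -/
def canonicalH (r : ℝ) (x : M) (v w : TangentSpace I x) : TangentSpace I x :=
  (1 / 2 : ℝ) • S.covDerivφ (leviCivita S.g) x v (S.φ x w)
    - (r * S.η x v) • S.φ x w
    + S.η x w • (S.φ x v - S.h x v)
    - (1 / 2 * S.g.inner x (S.φ x v - S.h x v) w) • S.ξ x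

/-- The `(1,2)`-tensor field `g(X, φY) ξ - r η(X) φY + η(Y) φX`; adding it to the Levi-Civita
connection gives the Okumura connection with parameter `r` on a Sasakian manifold. -/
def okumuraH (r : ℝ) (x : M) (v w : TangentSpace I x) : TangentSpace I x :=
  S.g.inner x v (S.φ x w) • S.ξ x - (r * S.η x v) • S.φ x w + S.η x w • S.φ x v

/-- `D` is a (smooth) linear connection that parallelizes `φ`, `ξ`, `η` and `g`, whose torsion
`T` is totally skew-symmetric on `ker η`, and for which `τ = T(ξ, ·)` satisfies
`τφ + φτ = -2(r+1)φ²`. -/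
structure IsCanonicalConnection (r : ℝ)
    (D : CovariantDerivative I E (fun x : M ↦ TangentSpace I x)) : Prop where
  smooth : D.ContMDiffCovariantDerivative ∞
  parallel_φ : ∀ (x : M) (v w : TangentSpace I x), S.covDerivφ D x v w = 0
  parallel_ξ : ∀ (x : M) (v : TangentSpace I x), D S.ξ x v = 0
  parallel_η : ∀ (x : M) (v : TangentSpace I x) (Y : Π x : M, TangentSpace I x),
    MDiffAt (T% Y) x → d% (fun y ↦ S.η y (Y y)) x v = S.η x (D Y x v)
  parallel_g : ∀ (x : M) (v : TangentSpace I x) (Y Z : Π x : M, TangentSpace I x),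
    MDiffAt (T% Y) x → MDiffAt (T% Z) x →
      d% (fun y ↦ S.g.inner y (Y y) (Z y)) x v =
        S.g.inner x (D Y x v) (Z x) + S.g.inner x (Y x) (D Z x v)
  torsion_skew : ∀ (x : M) (u v w : TangentSpace I x),
    S.η x u = 0 → S.η x v = 0 → S.η x w = 0 →
      S.g.inner x (D.torsion x u v) w = - S.g.inner x (D.torsion x v u) w ∧
      S.g.inner x (D.torsion x u v) w = - S.g.inner x (D.torsion x u w) v
  torsion_ξ : ∀ (x : M) (v : TangentSpace I x),
    D.torsion x (S.ξ x) (S.φ x v) + S.φ x (D.torsion x (S.ξ x) v) =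
      (-2 * (r + 1)) • S.φ x (S.φ x v)

end AlmostContactMetricStructure

end

end NearlySasakian

/-! Existence. For every almost contact metric structure, `∇ + H` already parallelizes `φ`, `ξ`, `η`
and `g`: `canonicalH_φ`, `canonicalH_ξ` and `canonicalH_skew` use only the skewness of `∇φ` and the
derivative of `φ² = -I + η ⊗ ξ`. The nearly Sasakian identity enters through the torsion. It gives
`hξ = 0`, `∇_ξ φ = φh`, `hφ = -φh`, and on `ker η` it makes `g((∇_u φ)v, w)` totally skew. There the
torsion is `g((∇_u φ)v, φw)`, again totally skew, and `τ = (3/2)h - (r+1)φ`; in `τφ + φτ` the `h`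
part cancels.

Uniqueness. Let `K` be the difference of two such connections. Each `K_u` is skew, commutes with `φ`
and kills `ξ`, so its image lies in `ker η`. The condition on `τ` gives `2φK_ξ = 0`, hence `K_ξ =
0`. On `ker η` the form `g(K(u, v), w)` is totally skew, and moving `φ` from one slot to another
changes the sign. Carrying `φ` around all three slots gives three signs, so the form equals its own
negative.

Sasakian case. The condition on `dη` forces `h = 0`, and normality kills the `ker η` part of `∇φ`.
So `(∇_X φ)φY = g(X, φY)ξ`, and `H` becomes the Okumura tensor.

Smoothness of `∇ + H` comes from the Koszul formula and the invertibility of the metric. -/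

namespace NearlySasakian

/-! ### Smoothness of the Levi-Civita connection. -/

section Smoothness

open scoped Topology

variable {E : Type*} [NormedAddCommGroup E] [NormedSpace ℝ E]
  {H : Type*} [TopologicalSpace H] {I : ModelWithCorners ℝ E H}
  {M : Type*} [TopologicalSpace M] [ChartedSpace H M]
  {F₁ F₂ : Type*} [NormedAddCommGroup F₁] [NormedSpace ℝ F₁]
  [NormedAddCommGroup F₂] [NormedSpace ℝ F₂]
  {V₁ V₂ : M → Type*} [TopologicalSpace (TotalSpace F₁ V₁)] [∀ x, AddCommGroup (V₁ x)]
  [∀ x, Module ℝ (V₁ x)] [∀ x, TopologicalSpace (V₁ x)]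
  [FiberBundle F₁ V₁] [VectorBundle ℝ F₁ V₁]
  [TopologicalSpace (TotalSpace F₂ V₂)] [∀ x, AddCommGroup (V₂ x)]
  [∀ x, Module ℝ (V₂ x)] [∀ x, TopologicalSpace (V₂ x)]
  [∀ x, IsTopologicalAddGroup (V₂ x)] [∀ x, ContinuousSMul ℝ (V₂ x)]
  [FiberBundle F₂ V₂] [VectorBundle ℝ F₂ V₂]
  {n : ℕ∞ω} {x : M}

/-- An operator-valued map on a manifold is smooth at a point if all its evaluations are. -/
lemma contMDiffAt_clm_of_apply [FiniteDimensional ℝ F₁] {f : M → F₁ →L[ℝ] F₂}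
    (h : ∀ v, CMDiffAt n (fun y ↦ f y v) x) : CMDiffAt n f x := by
  -- A basis of `F₁` turns an operator into the finite tuple of its columns.
  let e₁ : F₁ ≃L[ℝ] (Fin (Module.finrank ℝ F₁) → ℝ) := ContinuousLinearEquiv.ofFinrankEq (by simp)
  let e₂ := (e₁.arrowCongr (1 : F₂ ≃L[ℝ] F₂)).trans
    (ContinuousLinearEquiv.piRing (Fin (Module.finrank ℝ F₁)))
  have h2 : ContMDiffAt I 𝓘(ℝ, Fin (Module.finrank ℝ F₁) → F₂) n (fun y ↦ e₂ (f y)) x := by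
    exact contMDiffAt_pi_space.2 fun i ↦ h (e₁.symm (Pi.single i 1))
  have h3 : CMDiffAt n (fun y ↦ e₂.symm (e₂ (f y))) x :=
    e₂.symm.toContinuousLinearMap.contMDiff.contMDiffAt.comp x h2
  simpa using h3

/-- A section of a bundle of homomorphisms is smooth at a point if its values on smooth sections
are smooth at that point. -/
lemma contMDiffAt_hom_section [FiniteDimensional ℝ F₁] [∀ x, IsTopologicalAddGroup (V₁ x)]
    [∀ x, ContinuousSMul ℝ (V₁ x)] [ContMDiffVectorBundle n F₁ V₁ I]
    {A : Π y : M, V₁ y →L[ℝ] V₂ y}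
    (h : ∀ X : Π y : M, V₁ y, CMDiffAt n (T% X) x → CMDiffAt n (T% (fun y ↦ A y (X y))) x) :
    ContMDiffAt I (I.prod 𝓘(ℝ, F₁ →L[ℝ] F₂)) n
      (fun y ↦ TotalSpace.mk' (F₁ →L[ℝ] F₂) (E := fun y ↦ V₁ y →L[ℝ] V₂ y) y (A y)) x := by
  rw [contMDiffAt_hom_bundle]
  refine ⟨contMDiffAt_id, contMDiffAt_clm_of_apply fun v ↦ ?_⟩
  have hx : x ∈ (trivializationAt F₁ V₁ x).baseSet := mem_baseSet_trivializationAt F₁ V₁ x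
  have hx₂ : x ∈ (trivializationAt F₂ V₂ x).baseSet := mem_baseSet_trivializationAt F₂ V₂ x
  -- Test on sections that are constant in the trivialization; only their germ at `x` matters.
  have hX : CMDiffAt n (T% (fun y ↦ (trivializationAt F₁ V₁ x).symmL ℝ y v)) x := by
    rw [contMDiffAt_totalSpace]
    refine ⟨contMDiffAt_id, (contMDiffAt_const (c := v)).congr_of_eventuallyEq ?_⟩
    filter_upwards [(trivializationAt F₁ V₁ x).open_baseSet.mem_nhds hx] with y hy
    simp [hy]
  have h2 := h _ hX
  rw [contMDiffAt_totalSpace] at h2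
  refine h2.2.congr_of_eventuallyEq ?_
  filter_upwards [(trivializationAt F₁ V₁ x).open_baseSet.mem_nhds hx,
    (trivializationAt F₂ V₂ x).open_baseSet.mem_nhds hx₂] with y hy hy₂
  rw [ContinuousLinearMap.inCoordinates_eq hy hy₂]
  simp [hy]

/-- If `φ` is a smooth field of homomorphisms which is invertible at `x`, and `φ(Z)` is smooth at
`x`, then `Z` is smooth at `x`. -/
lemma contMDiffAt_of_clm_bundle_apply [CompleteSpace F₁] {φ : Π y : M, V₁ y →L[ℝ] V₂ y}
    (hφ : ContMDiffAt I (I.prod 𝓘(ℝ, F₁ →L[ℝ] F₂)) n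
      (fun y ↦ TotalSpace.mk' (F₁ →L[ℝ] F₂) (E := fun y ↦ V₁ y →L[ℝ] V₂ y) y (φ y)) x)
    (hx : (φ x).IsInvertible) {Z : Π y : M, V₁ y} (hZ : CMDiffAt n (T% (fun y ↦ φ y (Z y))) x) :
    CMDiffAt n (T% Z) x := by
  rw [contMDiffAt_hom_bundle] at hφ
  rw [contMDiffAt_totalSpace] at hZ ⊢
  have hx₁ : x ∈ (trivializationAt F₁ V₁ x).baseSet := mem_baseSet_trivializationAt F₁ V₁ x
  have hx₂ : x ∈ (trivializationAt F₂ V₂ x).baseSet := mem_baseSet_trivializationAt F₂ V₂ x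
  set G : M → F₁ →L[ℝ] F₂ := fun y ↦ ContinuousLinearMap.inCoordinates F₁ V₁ F₂ V₂ x y x y (φ y)
  have hG : CMDiffAt n G x := hφ.2
  have hGx : (G x).IsInvertible := by
    simp only [G]
    rw [ContinuousLinearMap.inCoordinates_eq hx₁ hx₂]
    exact ContinuousLinearMap.isInvertible_equiv.comp
      (hx.comp ContinuousLinearMap.isInvertible_equiv)
  have hinv : CMDiffAt n (fun y ↦ (G y).inverse) x :=
    hGx.contDiffAt_map_inverse.contMDiffAt.comp x hG
  refine ⟨contMDiffAt_id, (hinv.clm_apply hZ.2).congr_of_eventuallyEq ?_⟩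
  -- Invertibility is an open condition, so `Z = φ⁻¹(φ Z)` holds in coordinates on a whole
  -- neighbourhood.
  have hev : ∀ᶠ y in 𝓝 x, (G y).IsInvertible := by
    obtain ⟨e, he⟩ := hGx
    have := hG.continuousAt.preimage_mem_nhds (he ▸ ContinuousLinearEquiv.nhds e)
    filter_upwards [this] with y hy using hy
  filter_upwards [hev, (trivializationAt F₁ V₁ x).open_baseSet.mem_nhds hx₁,
    (trivializationAt F₂ V₂ x).open_baseSet.mem_nhds hx₂] with y hy hy₁ hy₂
  rw [eq_comm, hy.inverse_apply_eq]
  simp only [G]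
  rw [ContinuousLinearMap.inCoordinates_eq hy₁ hy₂]
  simp [hy₁]

variable [IsManifold I ∞ M]

lemma contMDiffAt_mvfderiv_apply {f : M → ℝ} {X : Π y : M, TangentSpace I y}
    (hf : CMDiffAt ∞ f x) (hX : CMDiffAt ∞ (T% X) x) : CMDiffAt ∞ (fun y ↦ d% f y (X y)) x := by
  have h1 := ContMDiffAt.mfderiv_const (m := ∞) hf (by simp)
  have h2 := ContMDiffAt.clm_apply_of_inCoordinates (b₁ := id) (b₂ := f)
    (F₁ := E) (F₂ := ℝ) (E₁ := TangentSpace I) (E₂ := TangentSpace 𝓘(ℝ, ℝ)) h1 hX hf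
  rw [contMDiffAt_totalSpace] at h2
  refine h2.2.congr_of_eventuallyEq ?_
  filter_upwards with y
  simp [mvfderiv]
  rfl


variable (g : ContMDiffRiemannianMetric I ∞ E (fun x : M ↦ TangentSpace I x))

lemma contMDiffAt_metric {X Y : Π x : M, TangentSpace I x} (hX : CMDiffAt ∞ (T% X) x)
    (hY : CMDiffAt ∞ (T% Y) x) : CMDiffAt ∞ (fun y ↦ g.inner y (X y) (Y y)) x := by
  have h : ContMDiffAt I (I.prod 𝓘(ℝ)) ∞
      (fun m : M ↦ TotalSpace.mk' ℝ (E := Bundle.Trivial M ℝ) m (g.inner m (X m) (Y m))) x := by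
    apply ContMDiffAt.clm_bundle_apply₂ (F₁ := E) (F₂ := E)
    · exact g.contMDiff x
    · exact hX
    · exact hY
  simp only [contMDiffAt_totalSpace] at h
  exact h.2

variable [FiniteDimensional ℝ E]

/-- Positivity makes `v ↦ g(v, ·)` injective, and a space and its dual have the same finite
dimension. -/
lemma isInvertible_metric (x : M) : (g.inner x).IsInvertible := by
  have key (B : E →L[ℝ] E →L[ℝ] ℝ) (hB : ∀ v, v ≠ 0 → 0 < B v v) : B.IsInvertible := by
    have hinj : Function.Injective B.toLinearMap := by
      refine (injective_iff_map_eq_zero _).2 fun v hv ↦ by_contra fun h ↦ (hB v h).ne' ?_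
      exact congr($hv v)
    have hdim : Module.finrank ℝ E = Module.finrank ℝ (E →L[ℝ] ℝ) := by
      rw [← (LinearMap.toContinuousLinearMap (𝕜 := ℝ) (E := E) (F' := ℝ)).finrank_eq]
      exact (Subspace.dual_finrank_eq (K := ℝ) (V := E)).symm
    exact ⟨(LinearEquiv.ofInjectiveOfFinrankEq B.toLinearMap hinj hdim).toContinuousLinearEquiv,
      by ext; rfl⟩
  exact key (g.inner x) (g.pos x)

/-- A vector field is smooth at a point if its inner products with smooth fields are. -/
lemma contMDiffAt_of_metric {Z : Π x : M, TangentSpace I x}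
    (h : ∀ W : Π x : M, TangentSpace I x, CMDiffAt ∞ (T% W) x →
      CMDiffAt ∞ (fun y ↦ g.inner y (Z y) (W y)) x) : CMDiffAt ∞ (T% Z) x := by
  have : CompleteSpace E := FiniteDimensional.complete ℝ E
  refine contMDiffAt_of_clm_bundle_apply (F₁ := E) (F₂ := E →L[ℝ] ℝ)
    (V₂ := fun y : M ↦ TangentSpace I y →L[ℝ] Bundle.Trivial M ℝ y) (φ := fun y ↦ g.inner y)
    (g.contMDiff x) (isInvertible_metric g x) ?_
  refine contMDiffAt_hom_section (F₁ := E) (F₂ := ℝ) (V₂ := Bundle.Trivial M ℝ) fun W hW ↦ ?_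
  rw [contMDiffAt_totalSpace]
  exact ⟨contMDiffAt_id, h W hW⟩

lemma contMDiffAt_koszul [CompleteSpace E] {X Y Z : Π x : M, TangentSpace I x}
    (hX : CMDiffAt ∞ (T% X) x) (hY : CMDiffAt ∞ (T% Y) x) (hZ : CMDiffAt ∞ (T% Z) x) :
    CMDiffAt ∞ (koszul g Y X Z) x := by
  have : IsManifold I (minSmoothness ℝ 2) M := .of_le (n := ∞) (by
    rw [minSmoothness_of_isRCLikeNormedField]
    exact WithTop.coe_le_coe.2 (le_top (a := (2 : ℕ∞))))
  have : IsManifold I (((⊤ : ℕ∞) : ℕ∞ω) + 1) M := .of_le (n := ∞) (by simp)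
  have hb {U V : Π x : M, TangentSpace I x} (hU : CMDiffAt ∞ (T% U) x)
      (hV : CMDiffAt ∞ (T% V) x) : CMDiffAt ∞ (T% (mlieBracket I U V)) x :=
    ContMDiffAt.mlieBracket_vectorField (m := ⊤) (n := ⊤) hU hV (by simp)
  unfold koszul
  exact ((((((contMDiffAt_mvfderiv_apply (contMDiffAt_metric g hY hZ) hX).add
    (contMDiffAt_mvfderiv_apply (contMDiffAt_metric g hX hZ) hY)).sub
    (contMDiffAt_mvfderiv_apply (contMDiffAt_metric g hX hY) hZ)).add
    (contMDiffAt_metric g (hb hX hY) hZ)).sub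
    (contMDiffAt_metric g (hb hX hZ) hY)).sub
    (contMDiffAt_metric g (hb hY hZ) hX))

lemma eventually_mdifferentiableAt {X : Π x : M, TangentSpace I x}
    (hX : CMDiffAt ∞ (T% X) x) : ∀ᶠ y in 𝓝 x, MDiffAt (T% X) y := by
  have h1 : CMDiffAt 1 (T% X) x := hX.of_le (by simp)
  filter_upwards [(contMDiffAt_iff_contMDiffAt_nhds (by simp)).1 h1] with y hy using
    hy.mdifferentiableAt (by simp)

/-- The pairings with smooth fields are half the Koszul expression. That formula needs
differentiability at each nearby point, not only at `x`. -/
lemma contMDiffAt_leviCivita_apply [CompleteSpace E] {X Y : Π x : M, TangentSpace I x}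
    (hX : CMDiffAt ∞ (T% X) x) (hY : CMDiffAt ∞ (T% Y) x) :
    CMDiffAt ∞ (T% (fun y ↦ leviCivita g Y y (X y))) x := by
  refine contMDiffAt_of_metric g fun W hW ↦ ?_
  refine (contMDiffAt_const (c := (1 / 2 : ℝ)).mul
    (contMDiffAt_koszul g hX hY hW)).congr_of_eventuallyEq ?_
  filter_upwards [eventually_mdifferentiableAt hX, eventually_mdifferentiableAt hY,
    eventually_mdifferentiableAt hW] with y hXy hYy hWy
  exact metric_leviCivitaFun g hXy hYy hWy

end Smoothness
end NearlySasakian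

namespace NearlySasakian

/-! ### Changing a connection by a tensor. -/

section

variable {E : Type*} [NormedAddCommGroup E] [NormedSpace ℝ E]
  {H : Type*} [TopologicalSpace H] {I : ModelWithCorners ℝ E H}
  {M : Type*} [TopologicalSpace M] [ChartedSpace H M] [IsManifold I ∞ M]

lemma metric_ext_right (g : ContMDiffRiemannianMetric I ∞ E (fun x : M ↦ TangentSpace I x)) {x : M}
    {v w : TangentSpace I x} (h : ∀ z, g.inner x v z = g.inner x w z) : v = w := by
  by_contra hne
  have h1 := g.pos x (v - w) (sub_ne_zero.mpr hne)
  have h2 := h (v - w)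
  rw [map_sub (g.inner x), sub_apply] at h1
  linarith

variable [CompleteSpace E] [FiniteDimensional ℝ E]
  {D D₀ : CovariantDerivative I E (fun x : M ↦ TangentSpace I x)}
  {A : Π x : M, TangentSpace I x → TangentSpace I x → TangentSpace I x}

lemma EqAdd.torsion (h : EqAdd D D₀ A) (x : M) (u v : TangentSpace I x) :
    D.torsion x u v = D₀.torsion x u v + (A x u v - A x v u) := by
  rw [D.torsion_apply_eq_extend, D₀.torsion_apply_eq_extend,
    h x _ _ (mdifferentiableAt_extend ..), h x _ _ (mdifferentiableAt_extend ..)]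
  simp only [extend_apply_self]
  abel

lemma EqAdd.covDerivφ (S : AlmostContactMetricStructure I M) (h : EqAdd D D₀ A) (x : M)
    (u v : TangentSpace I x) :
    S.covDerivφ D x u v = S.covDerivφ D₀ x u v + (A x u (S.φ x v) - S.φ x (A x u v)) := by
  have hv := mdifferentiableAt_extend I E v
  have h1 := S.covDerivφ_apply D u hv
  have h2 := S.covDerivφ_apply D₀ u hv
  rw [h x _ _ hv, h x _ _ (S.mdiffAt_φ hv)] at h1
  simp only [extend_apply_self, map_add] at h1 h2
  rw [h1, h2]
  abel

end

/-! ### Pointwise algebra of the structure, and derivatives of its tensors. -/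

namespace AlmostContactMetricStructure

variable {E : Type*} [NormedAddCommGroup E] [NormedSpace ℝ E]
  {H : Type*} [TopologicalSpace H] {I : ModelWithCorners ℝ E H}
  {M : Type*} [TopologicalSpace M] [ChartedSpace H M] [IsManifold I ∞ M]
  (S : AlmostContactMetricStructure I M) {x : M}

/-- From `φ²ξ = 0` and the formula for `φ²` at `φξ` one gets `φξ = cξ`; applying `φ` again yields
`c² = 0`. -/
lemma φ_ξ (x : M) : S.φ x (S.ξ x) = 0 := by
  have h1 : S.φ x (S.φ x (S.ξ x)) = 0 := by simp [S.φ_φ, S.η_ξ]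
  have h2 := S.φ_φ x (S.φ x (S.ξ x))
  rw [h1, map_zero] at h2
  have h3 : S.φ x (S.ξ x) = S.η x (S.φ x (S.ξ x)) • S.ξ x := by
    rw [eq_comm, ← sub_eq_zero, sub_eq_neg_add, ← h2]
  have h4 : S.η x (S.φ x (S.ξ x)) * S.η x (S.φ x (S.ξ x)) = 0 := by
    have := congr(S.η x (S.φ x $h3))
    simpa [h1] using this
  rw [h3, mul_self_eq_zero.1 h4, zero_smul]

lemma η_φ (v : TangentSpace I x) : S.η x (S.φ x v) = 0 := by
  have h1 := S.φ_φ x (S.φ x v)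
  have h2 := congr(S.η x (S.φ x $(S.φ_φ x v)))
  rw [h1] at h2
  simpa [S.φ_ξ, S.η_ξ] using h2

lemma g_ξ (v : TangentSpace I x) : S.g.inner x v (S.ξ x) = S.η x v := by
  have := S.g_φ_φ x v (S.ξ x)
  simp [S.φ_ξ, S.η_ξ] at this
  linarith

lemma g_ξ_left (v : TangentSpace I x) : S.g.inner x (S.ξ x) v = S.η x v := by
  rw [S.g.symm, S.g_ξ]

lemma g_φ_left (v w : TangentSpace I x) :
    S.g.inner x (S.φ x v) w = - S.g.inner x v (S.φ x w) := by
  have := S.g_φ_φ x v (S.φ x w)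
  simp [S.φ_φ, S.η_φ, S.g_ξ] at this
  linarith

/-- A vector is determined by its inner products with `ξ` and with the image of `φ`. -/
lemma ext_of_g_φ {v w : TangentSpace I x} (hη : S.η x v = S.η x w)
    (hφ : ∀ z, S.g.inner x v (S.φ x z) = S.g.inner x w (S.φ x z)) : v = w := by
  refine metric_ext_right S.g fun z ↦ ?_
  have hz : z = -S.φ x (S.φ x z) + S.η x z • S.ξ x := by simp [S.φ_φ]
  rw [hz]
  simp only [map_add, map_neg, map_smul, hφ, S.g_ξ, hη]

lemma mdiffAt_ξ : MDiffAt (T% S.ξ) x := (S.smooth_ξ x).mdifferentiableAt (by simp)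

lemma mdiffAt_η {Y : Π x : M, TangentSpace I x} (hY : MDiffAt (T% Y) x) :
    MDiffAt (fun y ↦ S.η y (Y y)) x := by
  simpa only [S.g_ξ] using mdiffAt_metric S.g hY S.mdiffAt_ξ

variable [FiniteDimensional ℝ E]

section CovDerivφ

variable (D : CovariantDerivative I E (fun x : M ↦ TangentSpace I x))

lemma covDerivφ_add_left (u v w : TangentSpace I x) :
    S.covDerivφ D x (u + v) w = S.covDerivφ D x u w + S.covDerivφ D x v w := map_add _ _ _

lemma covDerivφ_smul_left (c : ℝ) (v w : TangentSpace I x) :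
    S.covDerivφ D x (c • v) w = c • S.covDerivφ D x v w := map_smul _ _ _

lemma covDerivφ_add_right (u v w : TangentSpace I x) :
    S.covDerivφ D x u (v + w) = S.covDerivφ D x u v + S.covDerivφ D x u w := by
  simp [covDerivφ]

lemma covDerivφ_smul_right (c : ℝ) (v w : TangentSpace I x) :
    S.covDerivφ D x v (c • w) = c • S.covDerivφ D x v w := by
  simp [covDerivφ]

lemma covDerivφ_neg_right (v w : TangentSpace I x) :
    S.covDerivφ D x v (-w) = -S.covDerivφ D x v w := by
  simp [covDerivφ]

lemma covDerivφ_ξ (v : TangentSpace I x) :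
    S.covDerivφ D x v (S.ξ x) = -S.φ x (D S.ξ x v) := by
  have h : (fun y ↦ S.φ y (S.ξ y)) = 0 := funext S.φ_ξ
  rw [S.covDerivφ_apply D v S.mdiffAt_ξ, h, D.zero]
  simp

end CovDerivφ

variable [CompleteSpace E]

lemma mvfderiv_η {Y : Π x : M, TangentSpace I x} (hY : MDiffAt (T% Y) x) (v : TangentSpace I x) :
    d% (fun y ↦ S.η y (Y y)) x v =
      S.η x (leviCivita S.g Y x v) + S.g.inner x (leviCivita S.g S.ξ x v) (Y x) := by
  have := leviCivita_metric S.g hY S.mdiffAt_ξ v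
  simp only [S.g_ξ] at this
  rw [this, S.g.symm x (Y x)]

lemma η_leviCivita_ξ (v : TangentSpace I x) : S.η x (leviCivita S.g S.ξ x v) = 0 := by
  have := leviCivita_metric S.g S.mdiffAt_ξ S.mdiffAt_ξ v
  simp only [S.g_ξ, S.g_ξ_left, S.η_ξ] at this
  rw [mvfderiv_const, zero_apply] at this
  linarith

/-- `∇_v φ` is skew-symmetric. -/
lemma g_covDerivφ (u v w : TangentSpace I x) :
    S.g.inner x (S.covDerivφ (leviCivita S.g) x u v) w =
      -S.g.inner x (S.covDerivφ (leviCivita S.g) x u w) v := by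
  have hv := mdifferentiableAt_extend I E v
  have hw := mdifferentiableAt_extend I E w
  have h1 := S.covDerivφ_apply (leviCivita S.g) u hv
  have h2 := S.covDerivφ_apply (leviCivita S.g) u hw
  have h3 := leviCivita_metric S.g (S.mdiffAt_φ hv) hw u
  have h4 := leviCivita_metric S.g hv (S.mdiffAt_φ hw) u
  have h5 : (fun y ↦ S.g.inner y (S.φ y (extend E v y)) (extend E w y)) =
      fun y ↦ -S.g.inner y (extend E v y) (S.φ y (extend E w y)) := funext fun y ↦ S.g_φ_left _ _
  have h6 : d% (fun y ↦ -S.g.inner y (extend E v y) (S.φ y (extend E w y))) x u =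
      -d% (fun y ↦ S.g.inner y (extend E v y) (S.φ y (extend E w y))) x u := by
    rw [← neg_apply, ← mvfderiv_neg]
    rfl
  rw [h5, h6, h4] at h3
  simp only [extend_apply_self] at h1 h2 h3
  rw [h1, h2]
  simp only [map_sub, sub_apply, S.g_φ_left, S.g.symm x v] at h3 ⊢
  linarith

/-- The derivative of `φ² = -I + η ⊗ ξ`. -/
lemma covDerivφ_φ (u v : TangentSpace I x) :
    S.covDerivφ (leviCivita S.g) x u (S.φ x v) = -S.φ x (S.covDerivφ (leviCivita S.g) x u v)
      + S.g.inner x (leviCivita S.g S.ξ x u) v • S.ξ x + S.η x v • leviCivita S.g S.ξ x u := by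
  have hv := mdifferentiableAt_extend I E v
  have h1 := S.covDerivφ_apply (leviCivita S.g) u hv
  have h2 := S.covDerivφ_apply (leviCivita S.g) u (S.mdiffAt_φ hv)
  have h3 : (fun y ↦ S.φ y (S.φ y (extend E v y))) =
      (-1 : ℝ) • extend E v + (fun y ↦ S.η y (extend E v y)) • S.ξ := by
    ext y; simp [S.φ_φ]
  have hη := S.mdiffAt_η hv
  have h4 := (leviCivita S.g).isCovariantDerivativeOnUniv.add
    (hv.smul_const_section (a := (-1 : ℝ))) (hη.smul_section S.mdiffAt_ξ)
  have h5 := (leviCivita S.g).isCovariantDerivativeOnUniv.smul_const (-1) hv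
  have h6 := (leviCivita S.g).isCovariantDerivativeOnUniv.leibniz S.mdiffAt_ξ hη
  have h7 := S.mvfderiv_η hv u
  rw [h3, h4, h5, h6] at h2
  simp only [extend_apply_self] at h1 h2 h7
  rw [h1, h2]
  simp [h7, S.φ_φ]
  module

end AlmostContactMetricStructure
end NearlySasakian

/-! ### The tensor `h` and the nearly Sasakian identities. -/

namespace NearlySasakian
namespace AlmostContactMetricStructure

variable {E : Type*} [NormedAddCommGroup E] [NormedSpace ℝ E]
  {H : Type*} [TopologicalSpace H] {I : ModelWithCorners ℝ E H}
  {M : Type*} [TopologicalSpace M] [ChartedSpace H M] [IsManifold I ∞ M]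
  {S : AlmostContactMetricStructure I M} {x : M}

lemma eq_zero_of_φ_of_η {v : TangentSpace I x} (hφ : S.φ x v = 0) (hη : S.η x v = 0) : v = 0 := by
  have := S.φ_φ x v
  simpa [hφ, hη] using this

variable [FiniteDimensional ℝ E] [CompleteSpace E]

lemma h_apply (v : TangentSpace I x) : S.h x v = leviCivita S.g S.ξ x v + S.φ x v := rfl

lemma leviCivita_ξ (v : TangentSpace I x) : leviCivita S.g S.ξ x v = S.h x v - S.φ x v := by
  rw [h_apply, add_sub_cancel_right]

lemma η_h (v : TangentSpace I x) : S.η x (S.h x v) = 0 := by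
  rw [h_apply, map_add, S.η_leviCivita_ξ, S.η_φ, add_zero]

namespace IsNearlySasakian

variable (hS : S.IsNearlySasakian)
include hS

lemma leviCivita_ξ_ξ : leviCivita S.g S.ξ x (S.ξ x) = 0 := by
  refine eq_zero_of_φ_of_η ?_ (S.η_leviCivita_ξ _)
  have h := hS x (S.ξ x) (S.ξ x)
  simp only [S.covDerivφ_ξ, S.g_ξ, S.η_ξ] at h
  have h2 : (2 : ℝ) • S.φ x (leviCivita S.g S.ξ x (S.ξ x)) = 0 := by
    have : (2 * (1 : ℝ)) • S.ξ x - (1 : ℝ) • S.ξ x - (1 : ℝ) • S.ξ x = 0 := by module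
    rw [this] at h
    rw [two_smul, ← neg_eq_zero, neg_add, h]
  simpa using h2

lemma h_ξ : S.h x (S.ξ x) = 0 := by
  rw [h_apply, hS.leviCivita_ξ_ξ, S.φ_ξ, add_zero]

/-- The nearly Sasakian identity at `(ξ, v)`, where `(∇_v φ)ξ = -φ∇_v ξ`; the `φ²` term absorbs the
right-hand side. -/
lemma covDerivφ_ξ_left (v : TangentSpace I x) :
    S.covDerivφ (leviCivita S.g) x (S.ξ x) v = S.φ x (S.h x v) := by
  have h := hS x (S.ξ x) v
  rw [S.covDerivφ_ξ, leviCivita_ξ, S.η_ξ, S.g_ξ_left, map_sub, S.φ_φ] at h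
  rw [eq_sub_of_add_eq h]
  module

/-- Since `∇_ξ ξ = 0`, the derivative of `φ²` along `ξ` says that `∇_ξ φ = φh` anticommutes with
`φ`. -/
lemma h_φ (v : TangentSpace I x) : S.h x (S.φ x v) = -S.φ x (S.h x v) := by
  rw [eq_neg_iff_add_eq_zero]
  refine eq_zero_of_φ_of_η ?_ (by rw [map_add, η_h, S.η_φ, add_zero])
  have h := S.covDerivφ_φ (S.ξ x) v
  rw [hS.covDerivφ_ξ_left, hS.covDerivφ_ξ_left, hS.leviCivita_ξ_ξ] at h
  rw [map_add, h]
  simp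

/-- Skewness of `∇_ξ φ = φh`, tested against `φw`. -/
lemma g_h_left (v w : TangentSpace I x) :
    S.g.inner x (S.h x v) w = -S.g.inner x v (S.h x w) := by
  have h1 := S.g_covDerivφ (S.ξ x) v (S.φ x w)
  rw [hS.covDerivφ_ξ_left, hS.covDerivφ_ξ_left, hS.h_φ, S.g_φ_φ, η_h] at h1
  rw [S.g.symm x v]
  simpa [S.φ_φ, η_h] using h1

end IsNearlySasakian

/-- On `ker η` the form `g((∇_u φ) v, w)` is skew-symmetric in `u`, `v`. -/
lemma IsNearlySasakian.g_covDerivφ_swap (hS : S.IsNearlySasakian) {u v w : TangentSpace I x}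
    (hu : S.η x u = 0) (hv : S.η x v = 0) (hw : S.η x w = 0) :
    S.g.inner x (S.covDerivφ (leviCivita S.g) x u v) w =
      -S.g.inner x (S.covDerivφ (leviCivita S.g) x v u) w := by
  rw [eq_sub_of_add_eq (hS x u v)]
  simp [hu, hv, hw, S.g_ξ_left]

/-- On `ker η`, modulo `ξ`, `∇_u φ` anticommutes with `φ`; the skewness of `φ` supplies the second
sign. -/
lemma g_covDerivφ_φ {u v w : TangentSpace I x} (hv : S.η x v = 0) (hw : S.η x w = 0) :
    S.g.inner x (S.covDerivφ (leviCivita S.g) x u (S.φ x v)) w =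
      S.g.inner x (S.covDerivφ (leviCivita S.g) x u v) (S.φ x w) := by
  rw [S.covDerivφ_φ]
  simp [hv, hw, S.g_ξ_left, S.g_φ_left]

lemma IsNearlySasakian.g_covDerivφ_φ_left (hS : S.IsNearlySasakian) {u v w : TangentSpace I x}
    (hu : S.η x u = 0) (hv : S.η x v = 0) (hw : S.η x w = 0) :
    S.g.inner x (S.covDerivφ (leviCivita S.g) x (S.φ x u) v) w =
      S.g.inner x (S.covDerivφ (leviCivita S.g) x u v) (S.φ x w) := by
  rw [hS.g_covDerivφ_swap (S.η_φ u) hv hw, g_covDerivφ_φ hu hw,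
    ← hS.g_covDerivφ_swap hu hv (S.η_φ w)]

/-! ### The canonical connection. -/

variable (S) in
/-- The tensor field `canonicalH` as a continuous bilinear map, with the arguments swapped. -/
noncomputable def canonicalForm (r : ℝ) (x : M) :
    TangentSpace I x →L[ℝ] TangentSpace I x →L[ℝ] TangentSpace I x :=
  haveI : FiniteDimensional ℝ (TangentSpace I x) := inferInstanceAs (FiniteDimensional ℝ E)
  haveI : T2Space (TangentSpace I x) := inferInstanceAs (T2Space E)
  LinearMap.toContinuousLinearMap
    ((LinearMap.toContinuousLinearMap (𝕜 := ℝ) (E := TangentSpace I x)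
      (F' := TangentSpace I x)).toLinearMap ∘ₗ
      LinearMap.mk₂ ℝ (fun w v ↦ S.canonicalH r x v w)
        (fun w w' v ↦ by simp [canonicalH, covDerivφ_add_right]; module)
        (fun c w v ↦ by simp [canonicalH, covDerivφ_smul_right]; module)
        (fun w v v' ↦ by simp [canonicalH, covDerivφ_add_left]; module)
        (fun c w v ↦ by simp [canonicalH, covDerivφ_smul_left]; module))

variable (S) in
/-- The connection `∇ + canonicalH`. -/
noncomputable def canonicalConnection (r : ℝ) :
    CovariantDerivative I E (fun x : M ↦ TangentSpace I x) :=
  (leviCivita S.g).addOneForm (S.canonicalForm r)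

lemma eqAdd_canonicalConnection (r : ℝ) :
    EqAdd (S.canonicalConnection r) (leviCivita S.g) (S.canonicalH r) := fun _ _ _ _ ↦ rfl

lemma canonicalH_ξ (r : ℝ) (v : TangentSpace I x) :
    S.canonicalH r x v (S.ξ x) = S.φ x v - S.h x v := by
  have h0 : S.covDerivφ (leviCivita S.g) x v 0 = 0 := by
    simpa using S.covDerivφ_smul_right (leviCivita S.g) 0 v 0
  simp [canonicalH, S.φ_ξ, S.η_ξ, S.g_ξ, S.η_φ, η_h, h0]

/-- The term `1/2 (∇_u φ)φ` fails to be skew only by `η ⊗ ξ` terms coming from the derivative of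
`φ²`. The coefficients `1` and `-1/2` of the last two terms of `H` cancel this failure. -/
lemma canonicalH_skew (r : ℝ) (u v w : TangentSpace I x) :
    S.g.inner x (S.canonicalH r x u v) w = -S.g.inner x v (S.canonicalH r x u w) := by
  have h1 := S.g_covDerivφ u v (S.φ x w)
  have h2 := congr(S.g.inner x $(S.covDerivφ_φ u v) w)
  have h3 := S.g_φ_left v w
  rw [leviCivita_ξ] at h2
  have h4 := S.g.symm x (S.φ x w) v
  rw [S.g.symm x v (S.canonicalH r x u w)]
  simp only [canonicalH, map_add, map_sub, map_smul, map_neg, add_apply, sub_apply, smul_apply,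
    neg_apply, smul_eq_mul, S.g_ξ_left, S.g_φ_left (S.covDerivφ _ _ _ _)] at h1 h2 h3 h4 ⊢
  rw [h1] at h2
  rw [h2, h3, h4]
  ring

lemma canonicalH_φ (r : ℝ) (u v : TangentSpace I x) :
    S.covDerivφ (leviCivita S.g) x u v
      + (S.canonicalH r x u (S.φ x v) - S.φ x (S.canonicalH r x u v)) = 0 := by
  have h1 := S.covDerivφ_φ u (S.φ x v)
  have h2 := S.covDerivφ_ξ (leviCivita S.g) u
  rw [leviCivita_ξ] at h1 h2
  simp only [S.φ_φ x v, covDerivφ_add_right, covDerivφ_neg_right, covDerivφ_smul_right, h2] at h1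
  simp only [canonicalH, S.φ_φ x v, covDerivφ_add_right, covDerivφ_neg_right, covDerivφ_smul_right,
    h2]
  simp only [map_add, map_sub, map_smul, S.φ_ξ, S.η_φ, S.φ_φ x v, sub_apply] at h1 ⊢
  -- Half of the derivative of `φ²`, evaluated at `φv`.
  linear_combination (norm := module) (-1 / 2 : ℝ) • h1

end AlmostContactMetricStructure
end NearlySasakian

namespace NearlySasakian
namespace AlmostContactMetricStructure

variable {E : Type*} [NormedAddCommGroup E] [NormedSpace ℝ E]
  {H : Type*} [TopologicalSpace H] {I : ModelWithCorners ℝ E H}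
  {M : Type*} [TopologicalSpace M] [ChartedSpace H M] [IsManifold I ∞ M]
  {S : AlmostContactMetricStructure I M} {x : M}

lemma contMDiffAt_φ {Y : Π x : M, TangentSpace I x} (hY : CMDiffAt ∞ (T% Y) x) :
    CMDiffAt ∞ (T% (fun y ↦ S.φ y (Y y))) x :=
  ContMDiffAt.clm_bundle_apply (F₁ := E) (F₂ := E) (S.smooth_φ x) hY

lemma contMDiffAt_η {Y : Π x : M, TangentSpace I x} (hY : CMDiffAt ∞ (T% Y) x) :
    CMDiffAt ∞ (fun y ↦ S.η y (Y y)) x := by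
  simpa only [S.g_ξ] using contMDiffAt_metric S.g hY (S.smooth_ξ x)

variable [FiniteDimensional ℝ E] [CompleteSpace E]

lemma contMDiffAt_covDerivφ {X Y : Π x : M, TangentSpace I x} (hX : CMDiffAt ∞ (T% X) x)
    (hY : CMDiffAt ∞ (T% Y) x) :
    CMDiffAt ∞ (T% (fun y ↦ S.covDerivφ (leviCivita S.g) y (X y) (Y y))) x := by
  refine ((contMDiffAt_leviCivita_apply S.g hX (contMDiffAt_φ (S := S) hY)).sub_section
    (contMDiffAt_φ (S := S) (contMDiffAt_leviCivita_apply S.g hX hY))).congr_of_eventuallyEq ?_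
  filter_upwards [eventually_mdifferentiableAt hY] with y hy
  rw [S.covDerivφ_apply _ _ hy]
  rfl

lemma contMDiffAt_h {X : Π x : M, TangentSpace I x} (hX : CMDiffAt ∞ (T% X) x) :
    CMDiffAt ∞ (T% (fun y ↦ S.h y (X y))) x :=
  (contMDiffAt_leviCivita_apply S.g hX (S.smooth_ξ x)).add_section (contMDiffAt_φ (S := S) hX)

lemma contMDiffAt_canonicalH (r : ℝ) {X Y : Π x : M, TangentSpace I x}
    (hX : CMDiffAt ∞ (T% X) x) (hY : CMDiffAt ∞ (T% Y) x) :
    CMDiffAt ∞ (T% (fun y ↦ S.canonicalH r y (X y) (Y y))) x := by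
  have h1 := (contMDiffAt_φ (S := S) hX).sub_section (contMDiffAt_h (S := S) hX)
  exact ((((contMDiffAt_covDerivφ hX (contMDiffAt_φ (S := S) hY)).const_smul_section
    (a := (1 / 2 : ℝ))).sub_section
    ((contMDiffAt_const.mul (contMDiffAt_η hX)).smul_section (contMDiffAt_φ hY))).add_section
    ((contMDiffAt_η hY).smul_section h1)).sub_section
    ((contMDiffAt_const.mul (contMDiffAt_metric S.g h1 hY)).smul_section (S.smooth_ξ x))

lemma contMDiff_canonicalConnection (r : ℝ) :
    (S.canonicalConnection r).ContMDiffCovariantDerivative ∞ where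
  contMDiff := ⟨fun {Y} hY ↦ by
    intro x _
    have hY' : CMDiffAt ∞ (T% Y) x := (hY.contMDiffAt Filter.univ_mem).of_le (by simp)
    refine (contMDiffAt_hom_section fun X hX ↦ ?_).contMDiffWithinAt
    exact (contMDiffAt_leviCivita_apply S.g hX hY').add_section (contMDiffAt_canonicalH r hX hY')⟩

lemma torsion_canonicalConnection (r : ℝ) (u v : TangentSpace I x) :
    (S.canonicalConnection r).torsion x u v = S.canonicalH r x u v - S.canonicalH r x v u := by
  rw [(eqAdd_canonicalConnection r).torsion, leviCivita_torsion]
  simp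

lemma g_canonicalH {r : ℝ} {u v w : TangentSpace I x}
    (hu : S.η x u = 0) (hv : S.η x v = 0) (hw : S.η x w = 0) :
    S.g.inner x (S.canonicalH r x u v) w =
      1 / 2 * S.g.inner x (S.covDerivφ (leviCivita S.g) x u v) (S.φ x w) := by
  rw [← g_covDerivφ_φ hv hw]
  simp [canonicalH, hu, hv, hw, S.g_ξ_left]

lemma IsNearlySasakian.g_torsion_canonicalConnection (hS : S.IsNearlySasakian) (r : ℝ)
    {u v w : TangentSpace I x} (hu : S.η x u = 0) (hv : S.η x v = 0) (hw : S.η x w = 0) :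
    S.g.inner x ((S.canonicalConnection r).torsion x u v) w =
      S.g.inner x (S.covDerivφ (leviCivita S.g) x u v) (S.φ x w) := by
  rw [torsion_canonicalConnection, map_sub, sub_apply, g_canonicalH hu hv hw,
    g_canonicalH hv hu hw, hS.g_covDerivφ_swap hv hu (S.η_φ w)]
  ring

/-- Of the factor `3/2`, one half comes from `1/2 (∇_ξ φ)φv = 1/2 φhφv = 1/2 hv`, the rest from
`-H(v, ξ)`. -/
lemma IsNearlySasakian.torsion_ξ_canonicalConnection (hS : S.IsNearlySasakian) (r : ℝ)
    (v : TangentSpace I x) :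
    (S.canonicalConnection r).torsion x (S.ξ x) v =
      (3 / 2 : ℝ) • S.h x v - (r + 1) • S.φ x v := by
  rw [torsion_canonicalConnection, canonicalH_ξ, canonicalH, hS.covDerivφ_ξ_left, hS.h_φ, hS.h_ξ,
    S.φ_ξ, S.η_ξ, map_neg, S.φ_φ, η_h]
  simp
  module

theorem IsNearlySasakian.isCanonicalConnection (hS : S.IsNearlySasakian) (r : ℝ) :
    S.IsCanonicalConnection r (S.canonicalConnection r) where
  smooth := contMDiff_canonicalConnection r
  parallel_φ x v w := by
    rw [(eqAdd_canonicalConnection r).covDerivφ]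
    exact canonicalH_φ r v w
  parallel_ξ x v := by
    rw [eqAdd_canonicalConnection r x v S.ξ S.mdiffAt_ξ, canonicalH_ξ, leviCivita_ξ]
    abel
  parallel_η x v Y hY := by
    -- As `η = g(·, ξ)`, this is skewness of `H` against `ξ`.
    have h := canonicalH_skew (S := S) r v (Y x) (S.ξ x)
    rw [eqAdd_canonicalConnection r x v Y hY, S.mvfderiv_η hY, map_add]
    rw [S.g_ξ, canonicalH_ξ, S.g.symm] at h
    rw [h, leviCivita_ξ]
    simp
  parallel_g x v Y Z hY hZ := by
    have h := canonicalH_skew (S := S) r v (Y x) (Z x)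
    rw [leviCivita_metric S.g hY hZ, eqAdd_canonicalConnection r x v Y hY,
      eqAdd_canonicalConnection r x v Z hZ, map_add, map_add, add_apply, h]
    ring
  torsion_skew x u v w hu hv hw := by
    -- The first skewness holds for any torsion; the second is skewness of `∇_u φ` after moving `φ`
    -- across.
    refine ⟨by rw [CovariantDerivative.torsion_antisymm]; simp, ?_⟩
    rw [hS.g_torsion_canonicalConnection r hu hv hw, hS.g_torsion_canonicalConnection r hu hw hv,
      ← g_covDerivφ_φ hv hw, S.g_covDerivφ]
  torsion_ξ x v := by
    rw [hS.torsion_ξ_canonicalConnection, hS.torsion_ξ_canonicalConnection, hS.h_φ]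
    simp
    module

/-! ### Uniqueness. -/

/-- Two canonical connections with the same parameter coincide. -/
theorem IsCanonicalConnection.sameConnection {r : ℝ}
    {D D' : CovariantDerivative I E (fun x : M ↦ TangentSpace I x)}
    (hD : S.IsCanonicalConnection r D) (hD' : S.IsCanonicalConnection r D') :
    SameConnection D' D := by
  set K : Π x : M, TangentSpace I x → TangentSpace I x → TangentSpace I x :=
    fun x v w ↦ D'.difference D x w v with hKdef
  have hK : EqAdd D' D K := fun x v Y hY ↦ by
    have := IsCovariantDerivativeOn.difference_apply D'.isCovariantDerivativeOnUniv
      D.isCovariantDerivativeOnUniv (Set.mem_univ x) hY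
    simp only [hKdef, CovariantDerivative.difference]
    rw [this]
    simp
  suffices h : ∀ x (v w : TangentSpace I x), K x v w = 0 from
    fun x v Y hY ↦ by rw [hK x v Y hY, h, add_zero]
  intro x
  have hadd (u v w) : K x (u + v) w = K x u w + K x v w := map_add _ _ _
  have hsmul (c : ℝ) (v w) : K x (c • v) w = c • K x v w := map_smul _ _ _
  have hadd' (u v w) : K x u (v + w) = K x u v + K x u w := by simp [hKdef]
  have hsmul' (c : ℝ) (v w) : K x v (c • w) = c • K x v w := by simp [hKdef]
  have hKφ (v w) : K x v (S.φ x w) = S.φ x (K x v w) := by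
    have h := hK.covDerivφ S x v w
    rwa [hD.parallel_φ, hD'.parallel_φ, zero_add, eq_comm, sub_eq_zero] at h
  have hKξ (v) : K x v (S.ξ x) = 0 := by
    have h := hK x v S.ξ S.mdiffAt_ξ
    rwa [hD.parallel_ξ, hD'.parallel_ξ, zero_add, eq_comm] at h
  have hskew (u v w) : S.g.inner x (K x u v) w = -S.g.inner x (K x u w) v := by
    have hv := mdifferentiableAt_extend I E v
    have hw := mdifferentiableAt_extend I E w
    have h1 := hD.parallel_g x u _ _ hv hw
    have h2 := hD'.parallel_g x u _ _ hv hw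
    rw [hK x u _ hv, hK x u _ hw, h1] at h2
    simp only [extend_apply_self, map_add, add_apply] at h2
    rw [S.g.symm x (K x u w)]
    linarith
  have hηK (v w) : S.η x (K x v w) = 0 := by
    rw [← S.g_ξ, hskew, hKξ]; simp
  have hξK (v) : K x (S.ξ x) v = 0 := by
    have h1 := hD.torsion_ξ x v
    have h2 := hD'.torsion_ξ x v
    rw [hK.torsion, hK.torsion, hKξ, hKξ, hKφ] at h2
    refine eq_zero_of_φ_of_η ?_ (hηK _ _)
    have h3 : (2 : ℝ) • S.φ x (K x (S.ξ x) v) = 0 := by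
      rw [← h1] at h2
      simp only [map_add, sub_zero] at h2
      linear_combination (norm := module) h2
    simpa using h3
  -- on `ker η`, the form `g(K(u, v), w)` is totally skew-symmetric
  have hswap {u v w} (hu : S.η x u = 0) (hv : S.η x v = 0) (hw : S.η x w = 0) :
      S.g.inner x (K x u v) w = -S.g.inner x (K x v u) w := by
    -- In the torsion condition the terms with `u` as first argument cancel by `hskew`, leaving
    -- skewness in the outer slots; with `hskew` this generates all permutations.
    have key {u v w} (hu : S.η x u = 0) (hv : S.η x v = 0) (hw : S.η x w = 0) :
        S.g.inner x (K x w u) v = -S.g.inner x (K x v u) w := by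
      have h1 := (hD.torsion_skew x u v w hu hv hw).2
      have h2 := (hD'.torsion_skew x u v w hu hv hw).2
      simp only [hK.torsion, map_add, map_sub, add_apply, sub_apply] at h2
      linarith [hskew u v w]
    rw [hskew, key hw hv hu, hskew v w, neg_neg]
  have hφswap (u v w) : S.g.inner x (K x u (S.φ x v)) w = -S.g.inner x (K x u v) (S.φ x w) := by
    rw [hKφ, S.g_φ_left]
  have hker {u v} (hu : S.η x u = 0) (hv : S.η x v = 0) : K x u v = 0 := by
    refine S.ext_of_g_φ (by simp [hηK]) fun z ↦ ?_
    -- By `φ³ = -φ`, `z` may be replaced by its projection `-φ²z` to `ker η`.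
    have hz : S.φ x z = S.φ x (S.φ x (S.φ x (-z))) := by simp [S.φ_φ x z, S.φ_ξ]
    have hz0 : S.η x (S.φ x (S.φ x (-z))) = 0 := S.η_φ _
    rw [hz]
    set z₀ := S.φ x (S.φ x (-z))
    have h1 {v z} (hv : S.η x v = 0) (hz : S.η x z = 0) :
        S.g.inner x (K x (S.φ x u) v) z = -S.g.inner x (K x u v) (S.φ x z) := by
      rw [hswap (S.η_φ u) hv hz, hφswap, hswap hv hu (S.η_φ z)]
      ring
    have h2 := h1 hv hz0
    -- This carries `φ` from the first slot through the second to the third, against the direct move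
    -- in `h2`; the results differ by a sign.
    rw [hskew, h1 hz0 hv, hskew u z₀, hφswap] at h2
    rw [map_zero, zero_apply]
    linarith
  intro u v
  have hdec (z : TangentSpace I x) : z = S.φ x (S.φ x (-z)) + S.η x z • S.ξ x := by
    rw [S.φ_φ]; simp
  rw [hdec u, hdec v, hadd, hadd', hsmul, hξK, hsmul', hKξ, hker (S.η_φ _) (S.η_φ _)]
  simp


/-! ### The Sasakian case. -/

section Sasakian

lemma mlieBracket_eq_leviCivita {X Y : Π x : M, TangentSpace I x} (hX : MDiffAt (T% X) x)
    (hY : MDiffAt (T% Y) x) :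
    mlieBracket I X Y x = leviCivita S.g Y x (X x) - leviCivita S.g X x (Y x) :=
  ((CovariantDerivative.torsion_eq_zero_iff _).1 (leviCivita_torsion S.g) hX hY).symm

lemma dη_eq {X Y : Π x : M, TangentSpace I x} (hX : MDiffAt (T% X) x) (hY : MDiffAt (T% Y) x) :
    S.dη X Y x = S.g.inner x (leviCivita S.g S.ξ x (X x)) (Y x)
      - S.g.inner x (leviCivita S.g S.ξ x (Y x)) (X x) := by
  rw [dη, S.mvfderiv_η hX, S.mvfderiv_η hY, mlieBracket_eq_leviCivita (S := S) hX hY, map_sub]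
  ring

/-- Writing brackets as `∇_X Y - ∇_Y X` cancels all derivatives of the fields except those collected
in `∇φ`. -/
lemma normality_eq {X Y : Π x : M, TangentSpace I x} (hX : MDiffAt (T% X) x)
    (hY : MDiffAt (T% Y) x) :
    S.normality X Y x = S.covDerivφ (leviCivita S.g) x (S.φ x (X x)) (Y x)
      - S.covDerivφ (leviCivita S.g) x (S.φ x (Y x)) (X x)
      - S.φ x (S.covDerivφ (leviCivita S.g) x (X x) (Y x))
      + S.φ x (S.covDerivφ (leviCivita S.g) x (Y x) (X x)) + S.dη X Y x • S.ξ x := by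
  have hφX := S.mdiffAt_φ hX
  have hφY := S.mdiffAt_φ hY
  rw [normality, mlieBracket_eq_leviCivita (S := S) hX hY,
    mlieBracket_eq_leviCivita (S := S) hφX hφY, mlieBracket_eq_leviCivita (S := S) hφX hY,
    mlieBracket_eq_leviCivita (S := S) hX hφY]
  simp only [S.covDerivφ_apply _ _ hX, S.covDerivφ_apply _ _ hY, map_sub]
  abel

/-- A nearly Sasakian structure which is Sasakian has `h = 0`. -/
lemma IsNearlySasakian.h_eq_zero (hS : S.IsNearlySasakian) (hS' : S.IsSasakian)
    (v : TangentSpace I x) : S.h x v = 0 := by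
  refine metric_ext_right S.g fun w ↦ ?_
  have hv := mdifferentiableAt_extend I E v
  have hw := mdifferentiableAt_extend I E w
  have h := (hS' x (extend E v) (extend E w) (contMDiffAt_extend ..) (contMDiffAt_extend ..)).2
  -- Since `h` is skew, `dη(v, w) = 2g(hv, w) + 2g(v, φw)`.
  rw [dη_eq hv hw] at h
  simp only [extend_apply_self, leviCivita_ξ, map_sub, sub_apply] at h
  rw [S.g_φ_left v, hS.g_h_left w, S.g.symm x w, S.g.symm x (S.φ x w)] at h
  rw [map_zero, zero_apply]
  linarith

lemma IsNearlySasakian.covDerivφ_φ_of_isSasakian (hS : S.IsNearlySasakian) (hS' : S.IsSasakian)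
    (u v : TangentSpace I x) :
    S.covDerivφ (leviCivita S.g) x u (S.φ x v) = S.g.inner x u (S.φ x v) • S.ξ x := by
  -- On `ker η` the four `∇φ` terms of normality all equal `g((∇_u φ)v, φz)` after moving `φ` and
  -- swapping arguments, so four times it vanishes.
  have hker {u v z : TangentSpace I x} (hu : S.η x u = 0) (hv : S.η x v = 0)
      (hz : S.η x z = 0) : S.g.inner x (S.covDerivφ (leviCivita S.g) x u v) (S.φ x z) = 0 := by
    have h := (hS' x (extend E u) (extend E v) (contMDiffAt_extend ..)
      (contMDiffAt_extend ..)).1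
    rw [normality_eq (mdifferentiableAt_extend ..) (mdifferentiableAt_extend ..)] at h
    simp only [extend_apply_self] at h
    have h2 := congr(S.g.inner x $h z)
    simp only [map_add, map_sub, add_apply, sub_apply, map_smul, smul_apply, S.g_ξ_left, hz,
      hS.g_covDerivφ_φ_left hu hv hz, hS.g_covDerivφ_φ_left hv hu hz, S.g_φ_left, map_zero,
      zero_apply, smul_zero] at h2
    linarith [hS.g_covDerivφ_swap hv hu (S.η_φ z)]
  refine S.ext_of_g_φ ?_ fun z ↦ ?_
  · rw [← S.g_ξ, S.g_covDerivφ, S.covDerivφ_ξ, leviCivita_ξ, hS.h_eq_zero hS']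
    simp [S.φ_φ, S.η_ξ, S.g_ξ_left, S.η_φ]
  · have hu : u = S.φ x (S.φ x (-u)) + S.η x u • S.ξ x := by rw [S.φ_φ]; simp
    have hz : S.φ x z = S.φ x (S.φ x (S.φ x (-z))) := by simp [S.φ_φ x z, S.φ_ξ]
    rw [hu, covDerivφ_add_left, covDerivφ_smul_left, hS.covDerivφ_ξ_left, hS.h_eq_zero hS', hz,
      map_add, add_apply, hker (S.η_φ _) (S.η_φ _) (S.η_φ _)]
    simp [S.g_ξ_left, S.η_φ]

lemma IsNearlySasakian.canonicalH_eq_okumuraH (hS : S.IsNearlySasakian) (hS' : S.IsSasakian)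
    (r : ℝ) (u v : TangentSpace I x) : S.canonicalH r x u v = S.okumuraH r x u v := by
  rw [canonicalH, okumuraH, hS.covDerivφ_φ_of_isSasakian hS', hS.h_eq_zero hS', sub_zero,
    S.g_φ_left]
  module

end Sasakian

end AlmostContactMetricStructure
end NearlySasakian

theorem mainTheorem11 (n : ℕ) {M : Type*} [TopologicalSpace M] [T2Space M]
    [SecondCountableTopology M] [ChartedSpace (EuclideanSpace ℝ (Fin (2 * n + 1))) M]
    [IsManifold (𝓡 (2 * n + 1)) ∞ M]
    (S : NearlySasakian.AlmostContactMetricStructure (𝓡 (2 * n + 1)) M)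
    (hS : S.IsNearlySasakian) (r : ℝ) :
    ∃ D : CovariantDerivative (𝓡 (2 * n + 1)) (EuclideanSpace ℝ (Fin (2 * n + 1)))
        (fun x : M ↦ TangentSpace (𝓡 (2 * n + 1)) x),
      S.IsCanonicalConnection r D ∧
      (∀ D' : CovariantDerivative (𝓡 (2 * n + 1)) (EuclideanSpace ℝ (Fin (2 * n + 1)))
          (fun x : M ↦ TangentSpace (𝓡 (2 * n + 1)) x),
        S.IsCanonicalConnection r D' → NearlySasakian.SameConnection D' D) ∧
      NearlySasakian.EqAdd D (NearlySasakian.leviCivita S.g) (S.canonicalH r) ∧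
      (S.IsSasakian → NearlySasakian.EqAdd D (NearlySasakian.leviCivita S.g) (S.okumuraH r)) := by
  refine ⟨S.canonicalConnection r, hS.isCanonicalConnection r,
    fun D' hD' ↦ (hS.isCanonicalConnection r).sameConnection hD',
    S.eqAdd_canonicalConnection r, fun hS' x v Y hY ↦ ?_⟩
  rw [S.eqAdd_canonicalConnection r x v Y hY, hS.canonicalH_eq_okumuraH hS']
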